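/- Let $F$ be Thompson's group, i.e. the group, under composition, of all orientation-preserving piecewise linear homeomorphisms of $[0,1]$ with finitely many breakpoints, all of them dyadic rationals, and with all slopes integral powers of $2$. Let $F'=[F,F]$ be its commutator subgroup. For $f\in F'$ let $C(f)=\{hfh^{-1} : h\in F'\}$ be the conjugacy class of $f$ in $F'$, and let $C(f)^{\pm1}=C(f)\cup C(f)^{-1}$. Let $f$ be an arbitrary nonidentity element of $F'$. Then every element of $F'$ is a product of at most six elements of $C(f)^{\pm1}$. Consequently, $F'$ is a group of finite $C$-width: for every generating set $S$ of $F'$ that is invariant under all inner automorphisms of $F'$, there is a natural number $k$ such that every element of $F'$ is a product of at most $k$ elements of $S\cup S^{-1}$. -/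

import Mathlib

open scoped Pointwise

/-! ### Width of a group -/

/-- The length of `g` with respect to `S`: the least number of elements of `S ∪ S⁻¹` whose
product is `g` (and `⊤` if there is no such product). -/
noncomputable def wordLength {G : Type*} [Group G] (S : Set G) (g : G) : ℕ∞ :=
  ⨅ (l : List G) (_ : (∀ x ∈ l, x ∈ S ∪ S⁻¹) ∧ l.prod = g), (l.length : ℕ∞)

/-- The width of `G` with respect to `S`. -/
noncomputable def groupWidth (G : Type*) [Group G] (S : Set G) : ℕ∞ :=
  ⨆ g : G, wordLength S g

/-- `S` is invariant under all inner automorphisms. -/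
def IsConjInvariant {G : Type*} [Group G] (S : Set G) : Prop :=
  ∀ g : G, ∀ s ∈ S, g * s * g⁻¹ ∈ S

/-- `G` is a group of finite `C`-width: it has finite width with respect to every
conjugation-invariant generating set. -/
def HasFiniteCWidth (G : Type*) [Group G] : Prop :=
  ∀ S : Set G, Subgroup.closure S = ⊤ → IsConjInvariant S → groupWidth G S ≠ ⊤

/-! ### Thompson's group `F = PL₂([0,1])` -/

/-- Dyadic rationals, the elements of `ℤ[1/2]`. -/
def IsDyadicReal (x : ℝ) : Prop := ∃ (m : ℤ) (n : ℕ), x = m / 2 ^ n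

theorem IsDyadicReal.zero : IsDyadicReal 0 := ⟨0, 0, by simp⟩

theorem IsDyadicReal.add {x y : ℝ} (hx : IsDyadicReal x) (hy : IsDyadicReal y) :
    IsDyadicReal (x + y) := by
  obtain ⟨m, n, rfl⟩ := hx
  obtain ⟨p, q, rfl⟩ := hy
  refine ⟨m * 2 ^ q + p * 2 ^ n, n + q, ?_⟩
  push_cast
  field_simp
  ring

theorem IsDyadicReal.sub {x y : ℝ} (hx : IsDyadicReal x) (hy : IsDyadicReal y) :
    IsDyadicReal (x - y) := by
  obtain ⟨m, n, rfl⟩ := hx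
  obtain ⟨p, q, rfl⟩ := hy
  refine ⟨m * 2 ^ q - p * 2 ^ n, n + q, ?_⟩
  push_cast
  field_simp
  ring

theorem IsDyadicReal.zpow_mul {x : ℝ} (k : ℤ) (hx : IsDyadicReal x) :
    IsDyadicReal ((2 : ℝ) ^ k * x) := by
  obtain ⟨m, n, rfl⟩ := hx
  obtain ⟨j, rfl | rfl⟩ := k.eq_nat_or_neg
  · exact ⟨2 ^ j * m, n, by push_cast; rw [zpow_natCast]; ring⟩
  · exact ⟨m, n + j, by rw [zpow_neg, zpow_natCast]; field_simp; ring⟩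

/-- An increasing self-bijection `f` of `[0,1]` (that is, an orientation-preserving
homeomorphism) is piecewise linear with finitely many breakpoints, all of them dyadic, and with
slopes integral powers of two: there is a finite set `D` of dyadic points such that on every
interval `[a,b]` with no point of `D` in its interior `f` is affine of slope `2 ^ k`, `k ∈ ℤ`. -/
def IsPLTwo (f : unitInterval ≃o unitInterval) : Prop :=
  ∃ D : Finset unitInterval, (∀ d ∈ D, IsDyadicReal (d : ℝ)) ∧
    ∀ a b : unitInterval, (∀ d ∈ D, d ∉ Set.Ioo a b) →
      ∃ k : ℤ, ∀ x ∈ Set.Icc a b, ∀ y ∈ Set.Icc a b,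
        ((f y : unitInterval) : ℝ) - f x = (2 : ℝ) ^ k * ((y : ℝ) - x)

theorem IsPLTwo.dyadic {f : unitInterval ≃o unitInterval} (hf : IsPLTwo f) (x : unitInterval)
    (hx : IsDyadicReal (x : ℝ)) : IsDyadicReal ((f x : unitInterval) : ℝ) := by
  classical
  obtain ⟨D, hD, h⟩ := hf
  have key : ∀ a x : unitInterval, a ≤ x → (∀ d ∈ D, d ∉ Set.Ioo a x) →
      IsDyadicReal (a : ℝ) → IsDyadicReal ((f a : unitInterval) : ℝ) → IsDyadicReal (x : ℝ) →
      IsDyadicReal ((f x : unitInterval) : ℝ) := by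
    intro a x hax hd ha hfa hx
    obtain ⟨k, hk⟩ := h a x hd
    have e := hk a ⟨le_rfl, hax⟩ x ⟨hax, le_rfl⟩
    rw [sub_eq_iff_eq_add] at e
    rw [e]
    exact ((hx.sub ha).zpow_mul k).add hfa
  induction hn : (D.filter (· < x)).card using Nat.strong_induction_on generalizing x with
  | _ n ih =>
    by_cases hne : (D.filter (· < x)).Nonempty
    · have hm := Finset.max'_mem _ hne
      set a := (D.filter (· < x)).max' hne with ha
      obtain ⟨haD, hax⟩ := Finset.mem_filter.1 hm
      refine key a x hax.le ?_ (hD a haD) (ih _ ?_ a (hD a haD) rfl) hx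
      · intro d hd hdI
        exact absurd (Finset.le_max' _ d (Finset.mem_filter.2 ⟨hd, hdI.2⟩)) (not_le.2 hdI.1)
      · rw [← hn]
        apply Finset.card_lt_card
        refine ⟨fun d hd => ?_, fun hs => ?_⟩
        · obtain ⟨h1, h2⟩ := Finset.mem_filter.1 hd
          exact Finset.mem_filter.2 ⟨h1, h2.trans hax⟩
        · exact lt_irrefl a (Finset.mem_filter.1 (hs hm)).2
    · refine key 0 x unitInterval.nonneg' ?_ (by simpa using IsDyadicReal.zero) ?_ hx
      · intro d hd hdI
        exact hne ⟨d, Finset.mem_filter.2 ⟨hd, hdI.2⟩⟩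
      · have : f 0 = 0 := f.map_bot
        rw [this]
        simpa using IsDyadicReal.zero

theorem IsPLTwo.one : IsPLTwo 1 :=
  ⟨∅, by simp, fun _ _ _ => ⟨0, fun x _ y _ => by simp [RelIso.one_apply]⟩⟩

theorem IsPLTwo.inv {f : unitInterval ≃o unitInterval} (hf : IsPLTwo f) : IsPLTwo f⁻¹ := by
  classical
  have hdy := hf.dyadic
  obtain ⟨D, hD, h⟩ := hf
  refine ⟨D.image f, ?_, fun a b hab => ?_⟩
  · intro d hd
    obtain ⟨e, he, rfl⟩ := Finset.mem_image.1 hd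
    exact hdy e (hD e he)
  · obtain ⟨k, hk⟩ := h (f.symm a) (f.symm b) (fun d hd hI => hab (f d)
      (Finset.mem_image_of_mem _ hd) ⟨(f.symm_apply_lt).1 hI.1, (f.lt_symm_apply).1 hI.2⟩)
    refine ⟨-k, fun x hx y hy => ?_⟩
    have e := hk (f.symm x) ⟨f.symm.monotone hx.1, f.symm.monotone hx.2⟩
      (f.symm y) ⟨f.symm.monotone hy.1, f.symm.monotone hy.2⟩
    simp only [OrderIso.apply_symm_apply] at e
    change ((f.symm y : unitInterval) : ℝ) - f.symm x = _
    rw [e, ← mul_assoc, ← zpow_add₀ two_ne_zero]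
    simp

theorem IsPLTwo.mul {f g : unitInterval ≃o unitInterval} (hf : IsPLTwo f) (hg : IsPLTwo g) :
    IsPLTwo (f * g) := by
  classical
  have hdy := hg.inv.dyadic
  obtain ⟨D, hD, h⟩ := hf
  obtain ⟨E, hE, h'⟩ := hg
  refine ⟨E ∪ D.image g.symm, ?_, fun a b hab => ?_⟩
  · intro d hd
    rcases Finset.mem_union.1 hd with hd | hd
    · exact hE d hd
    · obtain ⟨e, he, rfl⟩ := Finset.mem_image.1 hd
      exact hdy e (hD e he)
  · obtain ⟨k, hk⟩ := h' a b (fun d hd => hab d (Finset.mem_union_left _ hd))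
    obtain ⟨l, hl⟩ := h (g a) (g b) (fun d hd hI => hab (g.symm d)
      (Finset.mem_union_right _ (Finset.mem_image_of_mem _ hd))
      ⟨(g.lt_symm_apply).2 hI.1, (g.symm_apply_lt).2 hI.2⟩)
    refine ⟨l + k, fun x hx y hy => ?_⟩
    have e := hl (g x) ⟨g.monotone hx.1, g.monotone hx.2⟩
      (g y) ⟨g.monotone hy.1, g.monotone hy.2⟩
    rw [RelIso.mul_apply, RelIso.mul_apply, e, hk x hx y hy, zpow_add₀ two_ne_zero, mul_assoc]

/-- Thompson's group `F`, realized as `PL₂([0,1])` under composition. -/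
def thompsonF : Subgroup (unitInterval ≃o unitInterval) where
  carrier := {f | IsPLTwo f}
  one_mem' := IsPLTwo.one
  mul_mem' := IsPLTwo.mul
  inv_mem' := IsPLTwo.inv

/-!
Extended by the identity, `F` acts on `ℝ`. Its elements commute near the endpoints of `[0, 1]`, so
`F'` has compact supports in `(0, 1)`; conjugating by a piecewise linear map of `ℝ` that is the
identity on the support of `g ∈ F'` and moves `[0, 1]` into its interior shows that `F' = [K, K]`,
where `K` is the group of compactly supported elements of `F`.

Conjugating `f^{±1}` by elements of `K` gives maps that move any `u` beyond any `v`. Let `g` be a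
product of commutators with supports in `[u, v]`, and let `t` be such a conjugate. As `t` displaces
`[u, v]`, the product collapses to `g = [α, β][w, t]` with `α, β, w ∈ K`, where `[w, t]` is a
product of two conjugates. If the conjugate `s` displaces a common support of `α` and `β`, then
`[α, β] = [α, [β, s]]` is a product of four. Finally, conjugating `f` by `k ∈ K` is the same as
conjugating it by `[k, t] ∈ F'` for a suitable `t`.
-/

open scoped commutatorElement

/-! ### Commutators and conjugates -/

section Group

variable {G : Type*} [Group G]

theorem commutatorElement_mul_mul_of_commute {a b c d : G} (hac : Commute a c) (had : Commute a d)
    (hbc : Commute b c) (hbd : Commute b d) : ⁅a * c, b * d⁆ = ⁅a, b⁆ * ⁅c, d⁆ := by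
  have commute_cd {x : G} (hc : Commute x c) (hd : Commute x d) : Commute x ⁅c, d⁆ := by
    rw [commutatorElement_def]
    exact ((hc.mul_right hd).mul_right hc.inv_right).mul_right hd.inv_right
  have hacd : Commute a ⁅c, d⁆ := commute_cd hac had
  have hbcd : Commute b ⁅c, d⁆ := commute_cd hbc hbd
  have habcd : Commute ⁅a, b⁆ ⁅c, d⁆ := by
    rw [commutatorElement_def a b]
    exact ((hacd.mul_left hbcd).mul_left hacd.inv_left).mul_left hbcd.inv_left
  rw [commutatorElement_mul_left_eq_conj_mul, commutatorElement_mul_right_eq_mul_conj,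
    commutatorElement_mul_right_eq_mul_conj, hbc.symm.commutator_eq,
    had.commutator_eq]
  simp only [one_mul, mul_one, hbcd.eq, mul_inv_cancel_right, hacd.eq, habcd.eq]

theorem eq_conj_mul_commutatorElement {g c w t : G} (hg : g = c * ⁅w, t⁆)
    (hcomm : Commute g (t * c * t⁻¹)) : g = t * c * t⁻¹ * ⁅g * (t * w * t⁻¹), t⁆ := by
  have hc : c⁻¹ = ⁅w, t⁆ * g⁻¹ := by rw [hg]; group
  calc g = t * c * t⁻¹ * (g * (t * c⁻¹ * t⁻¹)) := by
        rw [← mul_assoc, ← hcomm.eq]; group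
    _ = t * c * t⁻¹ * ⁅g * (t * w * t⁻¹), t⁆ := by
        rw [hc, commutatorElement_def, commutatorElement_def]; group

/-- Induction on the number of commutators: `⁅a, b⁆` and the conjugate of the previous product
by `t` merge into one commutator, because `t` moves `M` off `P`. -/
theorem exists_eq_commutator_mul_commutator {P M : Subgroup G} {t : G} (hPM : P ≤ M)
    (htM : ∀ m ∈ M, t * m * t⁻¹ ∈ M) (hcomm : ∀ p ∈ P, ∀ m ∈ M, Commute p (t * m * t⁻¹))
    {g : G} (hg : g ∈ ⁅P, P⁆) :
    ∃ α ∈ M, ∃ β ∈ M, ∃ w ∈ M, g = ⁅α, β⁆ * ⁅w, t⁆ := by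
  have commutator_mul : ∀ a ∈ P, ∀ b ∈ P, ∀ g ∈ P,
      (∃ α ∈ M, ∃ β ∈ M, ∃ w ∈ M, g = ⁅α, β⁆ * ⁅w, t⁆) →
      ∃ α ∈ M, ∃ β ∈ M, ∃ w ∈ M, ⁅a, b⁆ * g = ⁅α, β⁆ * ⁅w, t⁆ := by
    rintro a ha b hb g hg ⟨α, hα, β, hβ, w, hw, hgαβ⟩
    refine ⟨a * (t * α * t⁻¹), M.mul_mem (hPM ha) (htM α hα), b * (t * β * t⁻¹),
      M.mul_mem (hPM hb) (htM β hβ), g * (t * w * t⁻¹), M.mul_mem (hPM hg) (htM w hw), ?_⟩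
    rw [commutatorElement_mul_mul_of_commute (hcomm a ha α hα) (hcomm a ha β hβ)
      (hcomm b hb α hα) (hcomm b hb β hβ), ← conjugate_commutatorElement, mul_assoc,
      ← eq_conj_mul_commutatorElement hgαβ]
    exact hcomm g hg _ (M.commutator_le_self (Subgroup.commutator_mem_commutator hα hβ))
  have hPP : ∀ g ∈ ⁅P, P⁆, g ∈ P := fun _ h => P.commutator_le_self h
  rw [Subgroup.commutator_def] at hg
  induction hg using Subgroup.closure_induction_left with
  | one => exact ⟨1, M.one_mem, 1, M.one_mem, 1, M.one_mem, by simp⟩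
  | mul_left x hx y hy ih =>
    obtain ⟨a, ha, b, hb, rfl⟩ := hx
    exact commutator_mul a ha b hb y (hPP y hy) ih
  | inv_mul_cancel x hx y hy ih =>
    obtain ⟨a, ha, b, hb, rfl⟩ := hx
    rw [commutatorElement_inv]
    exact commutator_mul b hb a ha y (hPP y hy) ih

theorem commutatorElement_commutatorElement_of_commute {a b t : G}
    (h : Commute a (t * b * t⁻¹)) : ⁅a, ⁅b, t⁆⁆ = ⁅a, b⁆ := by
  have h' : Commute a (t * b⁻¹ * t⁻¹) := by simpa only [conj_inv] using h.inv_right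
  calc ⁅a, ⁅b, t⁆⁆ = a * b * (t * b⁻¹ * t⁻¹ * a⁻¹) * (t * b⁻¹ * t⁻¹)⁻¹ * b⁻¹ := by
        rw [commutatorElement_def, commutatorElement_def]; group
    _ = ⁅a, b⁆ := by rw [← h'.inv_left.eq, commutatorElement_def]; group

theorem commutatorElement_conj_eq_of_commute {f k t : G} (h : Commute f (t * k * t⁻¹)) :
    ⁅k, t⁆ * f * ⁅k, t⁆⁻¹ = k * f * k⁻¹ := by
  have h' : Commute (t * k⁻¹ * t⁻¹) f := by simpa only [conj_inv] using h.inv_right.symm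
  calc ⁅k, t⁆ * f * ⁅k, t⁆⁻¹ = k * ((t * k⁻¹ * t⁻¹) * f) * (t * k⁻¹ * t⁻¹)⁻¹ * k⁻¹ := by
        rw [commutatorElement_def]; group
    _ = k * f * k⁻¹ := by rw [h'.eq]; group

theorem mem_commutator_of_commute_of_conj_mem {H L : Subgroup G} {a g : G}
    (hg : g ∈ ⁅H, H⁆) (hag : Commute a g) (hHL : ∀ x ∈ H, a * x * a⁻¹ ∈ L) : g ∈ ⁅L, L⁆ := by
  have hmap : H.map (MulAut.conj a).toMonoidHom ≤ L := by
    rintro _ ⟨x, hx, rfl⟩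
    exact hHL x hx
  have hfix : MulAut.conj a g = g := by
    rw [MulAut.conj_apply, hag.eq, mul_inv_cancel_right]
  rw [← hfix]
  exact Subgroup.commutator_mono hmap hmap
    (Subgroup.map_commutator H H (MulAut.conj a).toMonoidHom ▸ Subgroup.mem_map_of_mem _ hg)

/-- The set of `H`-conjugates of `f` and of `f⁻¹`, so that `C(f)^{±1}` is the case `H = ⊤`. -/
def signedConjugates (H : Subgroup G) (f : G) : Set G :=
  {x | ∃ h ∈ H, x = h * f * h⁻¹ ∨ x = h * f⁻¹ * h⁻¹}

theorem signedConjugates_inv (H : Subgroup G) (f : G) :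
    (signedConjugates H f)⁻¹ = signedConjugates H f := by
  ext x
  refine exists_congr fun h => and_congr_right fun _ => ?_
  rw [or_comm, inv_eq_iff_eq_inv, inv_eq_iff_eq_inv, conj_inv, conj_inv, inv_inv]

theorem signedConjugates_subset {H : Subgroup G} {f : G} (hf : f ∈ H) :
    signedConjugates H f ⊆ H := by
  rintro x ⟨h, hh, rfl | rfl⟩
  · exact H.mul_mem (H.mul_mem hh hf) (H.inv_mem hh)
  · exact H.mul_mem (H.mul_mem hh (H.inv_mem hf)) (H.inv_mem hh)

theorem conj_mem_signedConjugates {H : Subgroup G} {f h x : G} (hh : h ∈ H)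
    (hx : x ∈ signedConjugates H f) : h * x * h⁻¹ ∈ signedConjugates H f := by
  obtain ⟨k, hk, rfl | rfl⟩ := hx
  · exact ⟨h * k, H.mul_mem hh hk, Or.inl (by group)⟩
  · exact ⟨h * k, H.mul_mem hh hk, Or.inr (by group)⟩

theorem image_conjugatesOf_union_inv {N : Type*} [Group N] (φ : G →* N) (f : G) :
    φ '' (conjugatesOf f ∪ (conjugatesOf f)⁻¹) = signedConjugates φ.range (φ f) := by
  ext x
  constructor
  · rintro ⟨y, hy | hy, rfl⟩ <;> obtain ⟨h, hh⟩ := isConj_iff.1 hy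
    · exact ⟨φ h, ⟨h, rfl⟩, Or.inl (by simp only [← hh, map_mul, map_inv])⟩
    · refine ⟨φ h, ⟨h, rfl⟩, Or.inr ?_⟩
      rw [← inv_inj, ← map_inv, ← hh, conj_inv, inv_inv, map_mul, map_mul, map_inv]
  · rintro ⟨_, ⟨h, rfl⟩, rfl | rfl⟩
    · exact ⟨h * f * h⁻¹, Or.inl (isConj_iff.2 ⟨h, rfl⟩), by simp only [map_mul, map_inv]⟩
    · refine ⟨h * f⁻¹ * h⁻¹, Or.inr (isConj_iff.2 ⟨h, ?_⟩), by simp only [map_mul, map_inv]⟩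
      rw [conj_inv, inv_inv]

theorem conj_mem_signedConjugates_pow {H : Subgroup G} {f h x : G} {n : ℕ} (hh : h ∈ H)
    (hx : x ∈ signedConjugates H f ^ n) : h * x * h⁻¹ ∈ signedConjugates H f ^ n := by
  have himage : MulAut.conj h '' signedConjugates H f ⊆ signedConjugates H f :=
    Set.image_subset_iff.2 fun _ => conj_mem_signedConjugates hh
  refine Set.pow_subset_pow_left himage ?_
  rw [← Set.image_pow]
  exact Set.mem_image_of_mem _ hx

theorem commutatorElement_mem_signedConjugates_pow {H : Subgroup G} {f h x : G} {n : ℕ}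
    (hh : h ∈ H) (hx : x ∈ signedConjugates H f ^ n) :
    ⁅h, x⁆ ∈ signedConjugates H f ^ (n + n) := by
  have hxinv : x⁻¹ ∈ signedConjugates H f ^ n := by
    rw [← signedConjugates_inv, inv_pow]
    exact Set.inv_mem_inv.2 hx
  rw [commutatorElement_def, pow_add]
  exact Set.mul_mem_mul (conj_mem_signedConjugates_pow hh hx) hxinv

theorem commutatorElement_mem_signedConjugates_pow_two {H : Subgroup G} {f h x : G}
    (hh : h ∈ H) (hx : x ∈ signedConjugates H f) : ⁅h, x⁆ ∈ signedConjugates H f ^ 2 :=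
  commutatorElement_mem_signedConjugates_pow (n := 1) hh (by rwa [pow_one])

end Group

/-! ### Supports of order automorphisms -/

section Support

variable {X : Type*} [Preorder X]

/-- The order automorphisms of `X` whose support is contained in `s`. -/
def supportedIn (s : Set X) : Subgroup (X ≃o X) :=
  fixingSubgroup (X ≃o X) sᶜ

theorem mem_supportedIn {s : Set X} {f : X ≃o X} : f ∈ supportedIn s ↔ ∀ x ∉ s, f x = x :=
  mem_fixingSubgroup_iff (X ≃o X)

theorem supportedIn_mono {s t : Set X} (hst : s ⊆ t) : supportedIn s ≤ supportedIn t :=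
  fixingSubgroup_antitone (X ≃o X) X (Set.compl_subset_compl.2 hst)

theorem conj_mem_supportedIn {s t : Set X} {f h : X ≃o X} (hf : f ∈ supportedIn s)
    (hst : ∀ x ∈ s, h x ∈ t) : h * f * h⁻¹ ∈ supportedIn t := by
  refine mem_supportedIn.2 fun x hx => ?_
  have hfix : f (h⁻¹ x) = h⁻¹ x := mem_supportedIn.1 hf _ fun hs => hx <| by
    simpa only [RelIso.apply_inv_self] using hst _ hs
  rw [RelIso.mul_apply, RelIso.mul_apply, hfix, RelIso.apply_inv_self]

theorem apply_mem_of_mem_supportedIn {s : Set X} {f : X ≃o X} (hf : f ∈ supportedIn s) {x : X}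
    (hx : x ∈ s) : f x ∈ s := by
  by_contra hfx
  exact hfx ((f.injective (mem_supportedIn.1 hf _ hfx)).symm ▸ hx)

theorem commute_of_mem_supportedIn {s t : Set X} (hst : Disjoint s t) {f g : X ≃o X}
    (hf : f ∈ supportedIn s) (hg : g ∈ supportedIn t) : Commute f g := by
  refine RelIso.ext fun x => ?_
  rw [RelIso.mul_apply, RelIso.mul_apply]
  by_cases hx : x ∈ s
  · rw [mem_supportedIn.1 hg x (hst.notMem_of_mem_left hx),
      mem_supportedIn.1 hg _ (hst.notMem_of_mem_left (apply_mem_of_mem_supportedIn hf hx))]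
  · by_cases hx' : x ∈ t
    · rw [mem_supportedIn.1 hf x hx, mem_supportedIn.1 hf _
        (hst.notMem_of_mem_right (apply_mem_of_mem_supportedIn hg hx'))]
    · rw [mem_supportedIn.1 hf x hx, mem_supportedIn.1 hg x hx', mem_supportedIn.1 hf x hx]

theorem commute_conj_of_le_apply {u v : X} {f g t : X ≃o X} (hf : f ∈ supportedIn (Set.Iio v))
    (hg : g ∈ supportedIn (Set.Ioi u)) (hvt : v ≤ t u) : Commute f (t * g * t⁻¹) :=
  commute_of_mem_supportedIn (Set.Iio_disjoint_Ioi_of_le hvt) hf <|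
    conj_mem_supportedIn hg fun _ hx => t.strictMono hx

end Support

/-! ### Proximal groups of order automorphisms -/

section Proximal

variable {X : Type*} [LinearOrder X]

/-- A group `K` of order automorphisms is proximal on `I` if its elements have supports with
bounds in `I` and it can carry any bounded part of `I` into any nondegenerate interval with
endpoints in `I`. -/
structure IsProximalOn (K : Subgroup (X ≃o X)) (I : Set X) : Prop where
  exists_mem_supportedIn : ∀ g ∈ K, ∃ u ∈ I, ∃ v ∈ I, g ∈ supportedIn (Set.Ioo u v)
  exists_compress : ∀ u ∈ I, ∀ v ∈ I, ∀ a ∈ I, ∀ b ∈ I, a < b → ∃ h ∈ K, a ≤ h u ∧ h v ≤ b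

namespace IsProximalOn

variable {K : Subgroup (X ≃o X)} {I : Set X}

theorem exists_common_support (hK : IsProximalOn K I) {f g : X ≃o X} (hf : f ∈ K) (hg : g ∈ K) :
    ∃ u ∈ I, ∃ v ∈ I, f ∈ supportedIn (Set.Ioo u v) ∧ g ∈ supportedIn (Set.Ioo u v) := by
  obtain ⟨u, hu, v, hv, hfuv⟩ := hK.exists_mem_supportedIn f hf
  obtain ⟨u', hu', v', hv', hguv⟩ := hK.exists_mem_supportedIn g hg
  exact ⟨min u u', min_rec' (· ∈ I) hu hu', max v v', max_rec' (· ∈ I) hv hv',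
    supportedIn_mono (Set.Ioo_subset_Ioo (min_le_left _ _) (le_max_left _ _)) hfuv,
    supportedIn_mono (Set.Ioo_subset_Ioo (min_le_right _ _) (le_max_right _ _)) hguv⟩

theorem exists_mem_commutator_supportedIn (hK : IsProximalOn K I) {g : X ≃o X}
    (hg : g ∈ ⁅K, K⁆) : ∃ u ∈ I, ∃ v ∈ I,
      g ∈ ⁅K ⊓ supportedIn (Set.Ioo u v), K ⊓ supportedIn (Set.Ioo u v)⁆ := by
  have mono {u v u' v' : X} (hu : u' ≤ u) (hv : v ≤ v') :
      K ⊓ supportedIn (Set.Ioo u v) ≤ K ⊓ supportedIn (Set.Ioo u' v') :=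
    inf_le_inf_left K (supportedIn_mono (Set.Ioo_subset_Ioo hu hv))
  rw [Subgroup.commutator_def] at hg
  induction hg using Subgroup.closure_induction with
  | mem x hx =>
    obtain ⟨a, ha, b, hb, rfl⟩ := hx
    obtain ⟨u, hu, v, hv, hauv, hbuv⟩ := hK.exists_common_support ha hb
    exact ⟨u, hu, v, hv, Subgroup.commutator_mem_commutator ⟨ha, hauv⟩ ⟨hb, hbuv⟩⟩
  | one =>
    obtain ⟨u, hu, v, hv, -⟩ := hK.exists_mem_supportedIn 1 K.one_mem
    exact ⟨u, hu, v, hv, Subgroup.one_mem _⟩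
  | mul x y _ _ ihx ihy =>
    obtain ⟨u, hu, v, hv, hx⟩ := ihx
    obtain ⟨u', hu', v', hv', hy⟩ := ihy
    have hxle := mono (min_le_left u u') (le_max_left v v')
    have hyle := mono (min_le_right u u') (le_max_right v v')
    exact ⟨min u u', min_rec' (· ∈ I) hu hu', max v v', max_rec' (· ∈ I) hv hv',
      Subgroup.mul_mem _ (Subgroup.commutator_mono hxle hxle hx)
        (Subgroup.commutator_mono hyle hyle hy)⟩
  | inv x _ ih =>
    obtain ⟨u, hu, v, hv, hx⟩ := ih
    exact ⟨u, hu, v, hv, Subgroup.inv_mem _ hx⟩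

variable [I.OrdConnected]

/-- If `s` moves `x` to the right and `h` compresses `[u, v]` into `[x, s x]`, then `h⁻¹ * s * h`
moves `u` beyond `v`. -/
theorem exists_signedConjugate_le_apply (hK : IsProximalOn K I) {f : X ≃o X} (hf : f ∈ K)
    (hne : f ≠ 1) {u v : X} (hu : u ∈ I) (hv : v ∈ I) :
    ∃ t ∈ signedConjugates K f, v ≤ t u := by
  obtain ⟨a, ha, b, hb, hfab⟩ := hK.exists_mem_supportedIn f hf
  obtain ⟨x, hx⟩ : ∃ x, f x ≠ x := not_forall.1 fun h => hne (RelIso.ext h)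
  have hxab : x ∈ Set.Ioo a b := by_contra fun h => hx (mem_supportedIn.1 hfab x h)
  have hmem {y : X} (hy : y ∈ Set.Ioo a b) : y ∈ I :=
    Set.OrdConnected.out ‹_› ha hb (Set.Ioo_subset_Icc_self hy)
  obtain ⟨s, hsf, hs, hxs⟩ : ∃ s, (s = f ∨ s = f⁻¹) ∧ s ∈ supportedIn (Set.Ioo a b) ∧ x < s x := by
    rcases hx.lt_or_gt with hlt | hgt
    · exact ⟨f⁻¹, Or.inr rfl, Subgroup.inv_mem _ hfab, f.lt_symm_apply.2 hlt⟩
    · exact ⟨f, Or.inl rfl, hfab, hgt⟩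
  obtain ⟨h, hh, hxu, hvs⟩ := hK.exists_compress u hu v hv x (hmem hxab) (s x)
    (hmem (apply_mem_of_mem_supportedIn hs hxab)) hxs
  refine ⟨h⁻¹ * s * h, ⟨h⁻¹, K.inv_mem hh, ?_⟩, ?_⟩
  · rw [inv_inv]
    exact hsf.imp (congrArg (h⁻¹ * · * h)) (congrArg (h⁻¹ * · * h))
  · rw [RelIso.mul_apply, RelIso.mul_apply]
    exact h.le_symm_apply.2 (hvs.trans (s.monotone hxu))

theorem signedConjugates_subset_commutator (hK : IsProximalOn K I) {f : X ≃o X} (hf : f ∈ K)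
    (hne : f ≠ 1) : signedConjugates K f ⊆ signedConjugates ⁅K, K⁆ f := by
  rintro x ⟨k, hk, hx⟩
  obtain ⟨u, hu, v, hv, hfuv, hkuv⟩ := hK.exists_common_support hf hk
  obtain ⟨t, ht, hvt⟩ := hK.exists_signedConjugate_le_apply hf hne hu hv
  have hcomm : Commute f (t * k * t⁻¹) := commute_conj_of_le_apply
    (supportedIn_mono Set.Ioo_subset_Iio_self hfuv) (supportedIn_mono Set.Ioo_subset_Ioi_self hkuv)
    hvt
  have hcomm' : Commute f⁻¹ (t * k * t⁻¹) := hcomm.inv_left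
  refine ⟨⁅k, t⁆, Subgroup.commutator_mem_commutator hk (signedConjugates_subset hf ht), ?_⟩
  rwa [commutatorElement_conj_eq_of_commute hcomm, commutatorElement_conj_eq_of_commute hcomm']

theorem commutatorElement_mem_pow_four (hK : IsProximalOn K I) {f α β : X ≃o X} (hf : f ∈ K)
    (hne : f ≠ 1) (hα : α ∈ K) (hβ : β ∈ K) : ⁅α, β⁆ ∈ signedConjugates K f ^ 4 := by
  obtain ⟨u, hu, v, hv, hαuv, hβuv⟩ := hK.exists_common_support hα hβ
  obtain ⟨s, hs, hvs⟩ := hK.exists_signedConjugate_le_apply hf hne hu hv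
  have hαβ : ⁅α, ⁅β, s⁆⁆ = ⁅α, β⁆ := commutatorElement_commutatorElement_of_commute <|
    commute_conj_of_le_apply (supportedIn_mono Set.Ioo_subset_Iio_self hαuv)
      (supportedIn_mono Set.Ioo_subset_Ioi_self hβuv) hvs
  rw [← hαβ]
  exact commutatorElement_mem_signedConjugates_pow (n := 2) hα
    (commutatorElement_mem_signedConjugates_pow_two hβ hs)

theorem exists_eq_commutator_mul_commutator_signedConjugate (hK : IsProximalOn K I)
    {f g : X ≃o X} (hf : f ∈ K) (hne : f ≠ 1) (hg : g ∈ ⁅K, K⁆) :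
    ∃ α ∈ K, ∃ β ∈ K, ∃ w ∈ K, ∃ t ∈ signedConjugates K f, g = ⁅α, β⁆ * ⁅w, t⁆ := by
  obtain ⟨u, hu, v, hv, hguv⟩ := hK.exists_mem_commutator_supportedIn hg
  obtain ⟨t, ht, huvt⟩ :=
    hK.exists_signedConjugate_le_apply hf hne hu (max_rec' (· ∈ I) hu hv)
  have htK : t ∈ K := signedConjugates_subset hf ht
  obtain ⟨α, hα, β, hβ, w, hw, hgt⟩ := exists_eq_commutator_mul_commutator
    (P := K ⊓ supportedIn (Set.Ioo u v)) (M := K ⊓ supportedIn (Set.Ioi u)) (t := t)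
    (inf_le_inf_left K (supportedIn_mono Set.Ioo_subset_Ioi_self))
    (fun m hm => ⟨K.mul_mem (K.mul_mem htK hm.1) (K.inv_mem htK), conj_mem_supportedIn hm.2
      fun x hx => ((le_max_left u v).trans huvt).trans_lt (t.strictMono hx)⟩)
    (fun p hp m hm => commute_conj_of_le_apply (supportedIn_mono Set.Ioo_subset_Iio_self hp.2)
      hm.2 ((le_max_right u v).trans huvt))
    hguv
  exact ⟨α, hα.1, β, hβ.1, w, hw.1, t, ht, hgt⟩

theorem mem_signedConjugates_pow_six (hK : IsProximalOn K I) {f g : X ≃o X} (hf : f ∈ K)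
    (hne : f ≠ 1) (hg : g ∈ ⁅K, K⁆) : g ∈ signedConjugates ⁅K, K⁆ f ^ 6 := by
  obtain ⟨α, hα, β, hβ, w, hw, t, ht, rfl⟩ :=
    hK.exists_eq_commutator_mul_commutator_signedConjugate hf hne hg
  refine Set.pow_subset_pow_left (hK.signedConjugates_subset_commutator hf hne) ?_
  rw [pow_add _ 4 2]
  exact Set.mul_mem_mul (hK.commutatorElement_mem_pow_four hf hne hα hβ)
    (commutatorElement_mem_signedConjugates_pow_two hw ht)

end IsProximalOn

end Proximal

section Push

open Set

theorem exists_le_pow_apply {X : Type*} [ConditionallyCompleteLinearOrder X] {f : X ≃o X}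
    {x y : X} (hf : ∀ z ∈ Icc x y, z < f z) : ∃ n : ℕ, y ≤ (f ^ n) x := by
  by_contra! hlt
  have hbdd : BddAbove (range fun n : ℕ => (f ^ n) x) :=
    ⟨y, forall_mem_range.2 fun n => (hlt n).le⟩
  set c := ⨆ n : ℕ, (f ^ n) x
  have hcmem : c ∈ Icc x y := ⟨le_ciSup hbdd 0, ciSup_le fun n => (hlt n).le⟩
  obtain ⟨n, hn⟩ := exists_lt_of_lt_ciSup (f.symm_apply_lt.2 (hf c hcmem))
  have hcn : c < (f ^ (n + 1)) x := by
    rw [pow_succ', RelIso.mul_apply]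
    exact f.symm_apply_lt.1 hn
  exact (le_ciSup hbdd (n + 1)).not_gt hcn

/-- To compress `[u, v]` into `[a, b]`, first pull `v` below `b`, then push `u` above `a` by a map
supported left of `b`, which keeps the image of `v` below `b`. -/
theorem isProximalOn_Ioo {X : Type*} [LinearOrder X] {K : Subgroup (X ≃o X)} {p q : X}
    (hsupp : ∀ g ∈ K, ∃ u ∈ Ioo p q, ∃ v ∈ Ioo p q, g ∈ supportedIn (Ioo u v))
    (hpush : ∀ b ∈ Ioc p q, ∀ x ∈ Ioo p b, ∀ y ∈ Ioo p b,
      ∃ h ∈ K ⊓ supportedIn (Ioo p b), y ≤ h x) : IsProximalOn K (Ioo p q) where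
  exists_mem_supportedIn := hsupp
  exists_compress u hu v hv a ha b hb hab := by
    obtain ⟨h, ⟨hhK, hhs⟩, hvb⟩ := hpush q ⟨hb.1.trans hb.2, le_rfl⟩ b hb v hv
    have hv' : h⁻¹ v ≤ b := h.symm_apply_le.2 hvb
    have hu' : h⁻¹ u ∈ Ioo p q := apply_mem_of_mem_supportedIn (Subgroup.inv_mem _ hhs) hu
    rcases le_or_gt a (h⁻¹ u) with hau | hua
    · exact ⟨h⁻¹, K.inv_mem hhK, hau, hv'⟩
    · obtain ⟨k, ⟨hkK, hks⟩, hak⟩ :=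
        hpush b ⟨hb.1, hb.2.le⟩ (h⁻¹ u) ⟨hu'.1, hua.trans hab⟩ a ⟨ha.1, hab⟩
      refine ⟨k * h⁻¹, K.mul_mem hkK (K.inv_mem hhK), hak, (k.monotone hv').trans_eq ?_⟩
      exact mem_supportedIn.1 hks b right_notMem_Ioo

end Push

section Germ

open Filter

variable {X : Type*} [Preorder X]

/-- The order automorphisms of `X` with trivial germ along `l`. -/
def eventuallyFixing (l : Filter X) : Subgroup (X ≃o X) where
  carrier := {f | ∀ᶠ x in l, f x = x}
  one_mem' := Eventually.of_forall fun _ => rfl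
  mul_mem' {f g} hf hg := by
    filter_upwards [hf, hg] with x hfx hgx
    rw [RelIso.mul_apply, hgx, hfx]
  inv_mem' {f} hf := by
    filter_upwards [hf] with x hfx
    exact f.symm_apply_eq.2 hfx.symm

theorem mem_eventuallyFixing {l : Filter X} {f : X ≃o X} :
    f ∈ eventuallyFixing l ↔ ∀ᶠ x in l, f x = x := Iff.rfl

theorem commutator_le_eventuallyFixing {H : Subgroup (X ≃o X)} {l : Filter X}
    (htendsto : ∀ f ∈ H, Tendsto f l l)
    (hcomm : ∀ f ∈ H, ∀ g ∈ H, ∀ᶠ x in l, f (g x) = g (f x)) : ⁅H, H⁆ ≤ eventuallyFixing l := by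
  refine Subgroup.commutator_le.2 fun f hf g hg => ?_
  have hgf : (g * f)⁻¹ ∈ H := H.inv_mem (H.mul_mem hg hf)
  refine ((htendsto _ hgf).eventually (hcomm f hf g hg)).mono fun x hx => ?_
  have hfg : ⁅f, g⁆ = f * g * (g * f)⁻¹ := by rw [commutatorElement_def]; group
  rw [hfg, RelIso.mul_apply, RelIso.mul_apply, hx, ← RelIso.mul_apply g f,
    RelIso.apply_inv_self]

end Germ

/-! ### Piecewise linear homeomorphisms of the line -/

theorem IsDyadicReal.one : IsDyadicReal 1 := ⟨1, 0, by simp⟩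

theorem IsDyadicReal.add_zpow_mul_sub {p x : ℝ} (k : ℤ) (hp : IsDyadicReal p)
    (hx : IsDyadicReal x) : IsDyadicReal (p + (2 : ℝ) ^ k * (x - p)) :=
  hp.add ((hx.sub hp).zpow_mul k)

theorem exists_isDyadicReal_between {a b : ℝ} (hab : a < b) :
    ∃ x ∈ Set.Ioo a b, IsDyadicReal x := by
  obtain ⟨n, hn⟩ := exists_pow_lt_of_lt_one (sub_pos.2 hab) (by norm_num : (1 / 2 : ℝ) < 1)
  have h2 : (0 : ℝ) < 2 ^ n := by positivity
  rw [one_div, inv_pow, inv_lt_iff_one_lt_mul₀ h2] at hn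
  refine ⟨(⌊a * 2 ^ n⌋ + 1 : ℤ) / 2 ^ n, ⟨?_, ?_⟩, _, n, rfl⟩
  · rw [lt_div_iff₀ h2, Int.cast_add, Int.cast_one]
    exact Int.lt_floor_add_one _
  · rw [div_lt_iff₀ h2, Int.cast_add, Int.cast_one]
    linarith [Int.floor_le (a * 2 ^ n)]

/-- `f` is affine on `s` with slope an integral power of two. -/
def IsAffineTwoOn (f : ℝ → ℝ) (s : Set ℝ) : Prop :=
  ∃ k : ℤ, ∀ x ∈ s, ∀ y ∈ s, f y - f x = (2 : ℝ) ^ k * (y - x)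

namespace IsAffineTwoOn

variable {f g : ℝ → ℝ} {s t : Set ℝ}

theorem comp (hf : IsAffineTwoOn f t) (hg : IsAffineTwoOn g s) (hst : Set.MapsTo g s t) :
    IsAffineTwoOn (f ∘ g) s := by
  obtain ⟨j, hj⟩ := hf
  obtain ⟨k, hk⟩ := hg
  refine ⟨j + k, fun x hx y hy => ?_⟩
  rw [zpow_add₀ two_ne_zero, mul_assoc, ← hk x hx y hy]
  exact hj _ (hst hx) _ (hst hy)

theorem of_rightInverse (hf : IsAffineTwoOn f t) (hfg : Function.RightInverse g f)
    (hst : Set.MapsTo g s t) : IsAffineTwoOn g s := by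
  obtain ⟨k, hk⟩ := hf
  refine ⟨-k, fun x hx y hy => ?_⟩
  rw [zpow_neg, eq_inv_mul_iff_mul_eq₀ (by positivity), ← hk _ (hst hx) _ (hst hy), hfg, hfg]

end IsAffineTwoOn

theorem disjoint_Ioo_apply {X : Type*} [Preorder X] (f : X ≃o X) {D : Set X} {a b : X} :
    Disjoint D (Set.Ioo (f a) (f b)) ↔ Disjoint (f ⁻¹' D) (Set.Ioo a b) := by
  rw [← f.image_Ioo, ← Set.disjoint_preimage_iff f.surjective, f.injective.preimage_image]

/-- The analogue of `thompsonF` on the line: the increasing bijections of `ℝ` that preserve the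
set of dyadic rationals and are piecewise linear with finitely many breakpoints, all of them
dyadic, and with slopes integral powers of two. On `[0, 1]` the first condition is automatic, as
`0` is fixed; on the line it excludes the translations by numbers that are not dyadic. -/
def plTwoReal : Subgroup (ℝ ≃o ℝ) where
  carrier := {f | (∀ x, IsDyadicReal (f x) ↔ IsDyadicReal x) ∧
    ∃ D : Set ℝ, D.Finite ∧ (∀ d ∈ D, IsDyadicReal d) ∧
      ∀ a b, Disjoint D (Set.Ioo a b) → IsAffineTwoOn f (Set.Icc a b)}
  one_mem' := ⟨fun _ => Iff.rfl, ∅, Set.finite_empty, by simp,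
    fun _ _ _ => ⟨0, fun x _ y _ => by simp [RelIso.one_apply]⟩⟩
  mul_mem' {f g} := by
    rintro ⟨hf, D, hD, hDdy, hfD⟩ ⟨hg, E, hE, hEdy, hgE⟩
    refine ⟨fun x => (hf _).trans (hg x), E ∪ g ⁻¹' D,
      hE.union (hD.preimage g.injective.injOn), ?_, fun a b hab => ?_⟩
    · rintro d (hd | hd)
      exacts [hEdy d hd, (hg d).1 (hDdy _ hd)]
    · rw [Set.disjoint_union_left, ← disjoint_Ioo_apply] at hab
      exact (hfD _ _ hab.2).comp (hgE _ _ hab.1) g.monotone.mapsTo_Icc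
  inv_mem' {f} := by
    rintro ⟨hf, D, hD, hDdy, hfD⟩
    have hfinv (x : ℝ) : IsDyadicReal (f⁻¹ x) ↔ IsDyadicReal x := by
      rw [← hf, RelIso.apply_inv_self]
    refine ⟨hfinv, (f⁻¹ : ℝ ≃o ℝ) ⁻¹' D, hD.preimage f⁻¹.injective.injOn,
      fun d hd => (hfinv d).1 (hDdy _ hd), fun a b hab => ?_⟩
    exact (hfD _ _ ((disjoint_Ioo_apply _).2 hab)).of_rightInverse (RelIso.apply_inv_self f)
      f⁻¹.monotone.mapsTo_Icc

/-- The underlying function of `kink p j k`. -/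
noncomputable def kinkFun (p : ℝ) (j k : ℤ) (x : ℝ) : ℝ :=
  if x ≤ p then p + (2 : ℝ) ^ j * (x - p) else p + (2 : ℝ) ^ k * (x - p)

theorem kinkFun_of_le {p x : ℝ} (j k : ℤ) (h : x ≤ p) :
    kinkFun p j k x = p + (2 : ℝ) ^ j * (x - p) := if_pos h

theorem kinkFun_of_ge {p x : ℝ} (j k : ℤ) (h : p ≤ x) :
    kinkFun p j k x = p + (2 : ℝ) ^ k * (x - p) := by
  rcases h.eq_or_lt with rfl | h
  · simp only [kinkFun, le_refl, sub_self, mul_zero, if_true]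
  · exact if_neg h.not_ge

theorem kinkFun_kinkFun (p : ℝ) (i j k l : ℤ) (x : ℝ) :
    kinkFun p i j (kinkFun p k l x) = kinkFun p (i + k) (j + l) x := by
  rcases le_total x p with h | h
  · have hkx : (2 : ℝ) ^ k * (x - p) ≤ 0 :=
      mul_nonpos_of_nonneg_of_nonpos (by positivity) (sub_nonpos.2 h)
    rw [kinkFun_of_le k l h, kinkFun_of_le _ _ h, kinkFun_of_le _ _ (add_le_of_nonpos_right hkx),
      add_sub_cancel_left, zpow_add₀ two_ne_zero, mul_assoc]
  · have hlx : 0 ≤ (2 : ℝ) ^ l * (x - p) := mul_nonneg (by positivity) (sub_nonneg.2 h)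
    rw [kinkFun_of_ge k l h, kinkFun_of_ge _ _ h, kinkFun_of_ge _ _ (le_add_of_nonneg_right hlx),
      add_sub_cancel_left, zpow_add₀ two_ne_zero, mul_assoc]

theorem kinkFun_zero (p x : ℝ) : kinkFun p 0 0 x = x := by
  simp only [kinkFun, zpow_zero, one_mul, add_sub_cancel, ite_self]

theorem kinkFun_strictMono (p : ℝ) (j k : ℤ) : StrictMono (kinkFun p j k) := by
  refine StrictMonoOn.Iic_union_Ici (a := p) (fun x hx y hy hxy => ?_) (fun x hx y hy hxy => ?_)
  · rw [kinkFun_of_le j k hx, kinkFun_of_le j k hy]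
    gcongr
  · rw [kinkFun_of_ge j k hx, kinkFun_of_ge j k hy]
    gcongr

/-- The homeomorphism of `ℝ` fixing `p`, of slope `2 ^ j` left of `p` and `2 ^ k` right of it.
These are the germs of the elements of `plTwoReal` at a fixed point `p`. -/
noncomputable def kink (p : ℝ) (j k : ℤ) : ℝ ≃o ℝ :=
  (kinkFun_strictMono p j k).orderIsoOfRightInverse _ (kinkFun p (-j) (-k)) fun x => by
    rw [kinkFun_kinkFun, add_neg_cancel, add_neg_cancel, kinkFun_zero]

theorem kink_apply (p : ℝ) (j k : ℤ) (x : ℝ) :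
    kink p j k x = if x ≤ p then p + (2 : ℝ) ^ j * (x - p) else p + (2 : ℝ) ^ k * (x - p) := rfl

theorem kink_of_le {p x : ℝ} (j k : ℤ) (h : x ≤ p) :
    kink p j k x = p + (2 : ℝ) ^ j * (x - p) := kinkFun_of_le j k h

theorem kink_of_ge {p x : ℝ} (j k : ℤ) (h : p ≤ x) :
    kink p j k x = p + (2 : ℝ) ^ k * (x - p) := kinkFun_of_ge j k h

theorem commute_kink (p : ℝ) (i j k l : ℤ) : Commute (kink p i j) (kink p k l) := by
  refine RelIso.ext fun x => (kinkFun_kinkFun p i j k l x).trans ?_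
  rw [add_comm i, add_comm j]
  exact (kinkFun_kinkFun p k l i j x).symm

theorem kink_mem_plTwoReal {p : ℝ} (hp : IsDyadicReal p) (j k : ℤ) : kink p j k ∈ plTwoReal := by
  have dyadic_kinkFun (j k : ℤ) {x : ℝ} (hx : IsDyadicReal x) : IsDyadicReal (kinkFun p j k x) := by
    unfold kinkFun
    split_ifs <;> exact hp.add_zpow_mul_sub _ hx
  refine ⟨fun x => ⟨fun hx => ?_, dyadic_kinkFun j k⟩, {p}, Set.finite_singleton p, by simpa,
    fun a b hab => ?_⟩
  · have hinv : kinkFun p (-j) (-k) (kinkFun p j k x) = x := by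
      rw [kinkFun_kinkFun, neg_add_cancel, neg_add_cancel, kinkFun_zero]
    exact hinv ▸ dyadic_kinkFun (-j) (-k) hx
  · rw [Set.disjoint_singleton_left, Set.mem_Ioo, not_and_or, not_lt, not_lt] at hab
    rcases hab with hpa | hbp
    · refine ⟨k, fun x hx y hy => ?_⟩
      rw [kink_of_ge j k (hpa.trans hx.1), kink_of_ge j k (hpa.trans hy.1)]
      ring
    · refine ⟨j, fun x hx y hy => ?_⟩
      rw [kink_of_le j k (hx.2.trans hbp), kink_of_le j k (hy.2.trans hbp)]
      ring

theorem IsDyadicReal.midpoint {p q : ℝ} (hp : IsDyadicReal p) (hq : IsDyadicReal q) :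
    IsDyadicReal ((p + q) / 2) := by
  have h := hp.add_zpow_mul_sub (-1) hq
  rwa [zpow_neg_one, show p + 2⁻¹ * (q - p) = (p + q) / 2 by ring] at h

theorem exists_bump {p q : ℝ} (hp : IsDyadicReal p) (hq : IsDyadicReal q) (hpq : p < q) :
    ∃ h ∈ plTwoReal ⊓ supportedIn (Set.Ioo p q), ∀ x ∈ Set.Ioo p q, x < h x := by
  obtain ⟨r, hr, hrpq⟩ : ∃ r, IsDyadicReal r ∧ r = (p + q) / 2 := ⟨_, hp.midpoint hq, rfl⟩
  obtain ⟨s, hs, hsrq⟩ : ∃ s, IsDyadicReal s ∧ s = (r + q) / 2 := ⟨_, hr.midpoint hq, rfl⟩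
  -- The slopes of `h` on `[p, q]` are `2`, `1` and `1 / 2`.
  let h := kink q 0 1 * kink s 0 (-1) * kink r 0 (-1) * kink p 0 1
  have hh : h ∈ plTwoReal := plTwoReal.mul_mem (plTwoReal.mul_mem (plTwoReal.mul_mem
    (kink_mem_plTwoReal hq 0 1) (kink_mem_plTwoReal hs 0 (-1))) (kink_mem_plTwoReal hr 0 (-1)))
    (kink_mem_plTwoReal hp 0 1)
  have h_apply (x : ℝ) : h x = kink q 0 1 (kink s 0 (-1) (kink r 0 (-1) (kink p 0 1 x))) := rfl
  simp only [kink_apply, zpow_zero, zpow_one, zpow_neg_one, one_mul, add_sub_cancel] at h_apply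
  refine ⟨h, ⟨hh, mem_supportedIn.2 fun x hx => ?_⟩, fun x hx => ?_⟩
  · rw [Set.mem_Ioo, not_and_or, not_lt, not_lt] at hx
    grind
  · grind

theorem exists_eventuallyEq_kink {f : ℝ ≃o ℝ} (hf : f ∈ plTwoReal) {p : ℝ} (hfp : f p = p) :
    ∃ j k : ℤ, f =ᶠ[nhds p] kink p j k := by
  obtain ⟨-, D, hD, -, hfD⟩ := hf
  have hDp : ∀ᶠ x in nhds p, x ≠ p → x ∉ D :=
    eventually_nhdsWithin_iff.1 (nhdsNE_le_cofinite p hD.compl_mem_cofinite)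
  obtain ⟨a, b, hp, hab⟩ := mem_nhds_iff_exists_Ioo_subset.1 hDp
  obtain ⟨j, hj⟩ := hfD a p <| Set.disjoint_right.2 fun x hx =>
    hab ⟨hx.1, hx.2.trans hp.2⟩ hx.2.ne
  obtain ⟨k, hk⟩ := hfD p b <| Set.disjoint_right.2 fun x hx =>
    hab ⟨hp.1.trans hx.1, hx.2⟩ hx.1.ne'
  refine ⟨j, k, Filter.eventually_of_mem (Ioo_mem_nhds hp.1 hp.2) fun x hx => ?_⟩
  rcases le_total x p with hxp | hpx
  · rw [kink_of_le j k hxp, ← hj p ⟨hp.1.le, le_rfl⟩ x ⟨hx.1.le, hxp⟩, hfp, add_sub_cancel]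
  · rw [kink_of_ge j k hpx, ← hk p ⟨le_rfl, hp.2.le⟩ x ⟨hpx, hx.2.le⟩, hfp, add_sub_cancel]

theorem commutator_le_eventuallyFixing_nhds {H : Subgroup (ℝ ≃o ℝ)} {p : ℝ} (hH : H ≤ plTwoReal)
    (hp : ∀ f ∈ H, f p = p) : ⁅H, H⁆ ≤ eventuallyFixing (nhds p) := by
  have htendsto : ∀ f ∈ H, Filter.Tendsto f (nhds p) (nhds p) :=
    fun f hf => f.continuous.tendsto' p p (hp f hf)
  refine commutator_le_eventuallyFixing htendsto fun f hf g hg => ?_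
  obtain ⟨i, j, hfp⟩ := exists_eventuallyEq_kink (hH hf) (hp f hf)
  obtain ⟨k, l, hgp⟩ := exists_eventuallyEq_kink (hH hg) (hp g hg)
  filter_upwards [hfp, hgp, (htendsto g hg).eventually hfp, (htendsto f hf).eventually hgp]
    with x hfx hgx hfgx hgfx
  rw [hfgx, hgfx, hfx, hgx, ← RelIso.mul_apply, (commute_kink p i j k l).eq, RelIso.mul_apply]

/-- The copy of Thompson's group consisting of the elements of `plTwoReal` that are the identity
outside `(a, b)`. -/
noncomputable def plTwoOn (a b : ℝ) : Subgroup (ℝ ≃o ℝ) :=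
  plTwoReal ⊓ supportedIn (Set.Ioo a b)

/-- The elements of `plTwoOn a b` with compact support in `(a, b)`, encoded as those with trivial
germs at `a` and `b`. -/
noncomputable def plTwoCompactOn (a b : ℝ) : Subgroup (ℝ ≃o ℝ) :=
  plTwoOn a b ⊓ eventuallyFixing (nhds a ⊔ nhds b)

section

variable {a b : ℝ}

theorem plTwoReal_inf_supportedIn_le {u v : ℝ} (hau : a < u) (hvb : v < b) :
    plTwoReal ⊓ supportedIn (Set.Ioo u v) ≤ plTwoCompactOn a b := by
  refine fun f hf => ⟨⟨hf.1, supportedIn_mono (Set.Ioo_subset_Ioo hau.le hvb.le) hf.2⟩,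
    Filter.eventually_sup.2 ⟨?_, ?_⟩⟩
  · filter_upwards [Iio_mem_nhds hau] with x hx
    exact mem_supportedIn.1 hf.2 x fun h => h.1.not_gt hx
  · filter_upwards [Ioi_mem_nhds hvb] with x hx
    exact mem_supportedIn.1 hf.2 x fun h => h.2.not_gt hx

theorem exists_mem_supportedIn_of_mem_plTwoCompactOn (hab : a < b) {f : ℝ ≃o ℝ}
    (hf : f ∈ plTwoCompactOn a b) :
    ∃ u ∈ Set.Ioo a b, ∃ v ∈ Set.Ioo a b, f ∈ supportedIn (Set.Ioo u v) := by
  obtain ⟨hfa, hfb⟩ := Filter.eventually_sup.1 (mem_eventuallyFixing.1 hf.2)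
  obtain ⟨u, hau, hu⟩ := (mem_nhdsGT_iff_exists_Ioc_subset (a := a)).1 <|
    Filter.inter_mem (Ioo_mem_nhdsGT hab) (mem_nhdsWithin_of_mem_nhds hfa)
  obtain ⟨v, hvb, hv⟩ := (mem_nhdsLT_iff_exists_Ico_subset (a := b)).1 <|
    Filter.inter_mem (Ioo_mem_nhdsLT hab) (mem_nhdsWithin_of_mem_nhds hfb)
  refine ⟨u, (hu ⟨hau, le_rfl⟩).1, v, (hv ⟨le_rfl, hvb⟩).1, mem_supportedIn.2 fun x hx => ?_⟩
  by_cases hxab : x ∈ Set.Ioo a b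
  · rw [Set.mem_Ioo, not_and_or, not_lt, not_lt] at hx
    rcases hx with hxu | hvx
    exacts [(hu ⟨hxab.1, hxu⟩).2, (hv ⟨hvx, hxab.2⟩).2]
  · exact mem_supportedIn.1 hf.1.2 x hxab

theorem commutator_plTwoOn_le : ⁅plTwoOn a b, plTwoOn a b⁆ ≤ plTwoCompactOn a b := by
  have fixes {p : ℝ} (hp : p ∉ Set.Ioo a b) : ∀ f ∈ plTwoOn a b, f p = p :=
    fun f hf => mem_supportedIn.1 hf.2 p hp
  refine fun f hf => ⟨Subgroup.commutator_le_self _ hf, Filter.eventually_sup.2 ⟨?_, ?_⟩⟩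
  · exact commutator_le_eventuallyFixing_nhds inf_le_left (fixes Set.left_notMem_Ioo) hf
  · exact commutator_le_eventuallyFixing_nhds inf_le_left (fixes Set.right_notMem_Ioo) hf

theorem exists_shrink {u v : ℝ} (hu : u ∈ Set.Ioo a b) (hv : v ∈ Set.Ioo a b) :
    ∃ A ∈ plTwoReal ⊓ supportedIn (Set.Ioo u v)ᶜ, a < A a ∧ A b < b := by
  obtain ⟨p, ⟨hap, hpu⟩, hp⟩ := exists_isDyadicReal_between hu.1
  obtain ⟨q, ⟨hvq, hqb⟩, hq⟩ := exists_isDyadicReal_between hv.2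
  let A := kink p (-1) 0 * kink q 0 (-1)
  have hA : A ∈ plTwoReal :=
    plTwoReal.mul_mem (kink_mem_plTwoReal hp (-1) 0) (kink_mem_plTwoReal hq 0 (-1))
  have A_apply (x : ℝ) : A x = kink p (-1) 0 (kink q 0 (-1) x) := rfl
  simp only [kink_apply, zpow_zero, zpow_neg_one, one_mul, add_sub_cancel] at A_apply
  refine ⟨A, ⟨hA, mem_supportedIn.2 fun x hx => ?_⟩, ?_, ?_⟩
  · obtain ⟨hux, hxv⟩ := Set.notMem_compl_iff.1 hx
    grind
  all_goals grind

theorem commutator_plTwoOn_eq (hab : a < b) :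
    ⁅plTwoOn a b, plTwoOn a b⁆ = ⁅plTwoCompactOn a b, plTwoCompactOn a b⁆ := by
  refine le_antisymm (fun g hg => ?_) (Subgroup.commutator_mono inf_le_left inf_le_left)
  obtain ⟨u, hu, v, hv, hguv⟩ :=
    exists_mem_supportedIn_of_mem_plTwoCompactOn hab (commutator_plTwoOn_le hg)
  obtain ⟨A, ⟨hA, hAuv⟩, haA, hAb⟩ := exists_shrink hu hv
  refine mem_commutator_of_commute_of_conj_mem hg
    (commute_of_mem_supportedIn disjoint_compl_left hAuv hguv) fun f hf => ?_
  refine plTwoReal_inf_supportedIn_le haA hAb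
    ⟨plTwoReal.mul_mem (plTwoReal.mul_mem hA hf.1) (plTwoReal.inv_mem hA), ?_⟩
  exact conj_mem_supportedIn hf.2 fun x hx => ⟨A.strictMono hx.1, A.strictMono hx.2⟩

theorem isProximalOn_plTwoCompactOn (hab : a < b) :
    IsProximalOn (plTwoCompactOn a b) (Set.Ioo a b) := by
  refine isProximalOn_Ioo (fun g => exists_mem_supportedIn_of_mem_plTwoCompactOn hab)
    fun c hc x hx y hy => ?_
  rcases le_or_gt y x with hyx | hxy
  · exact ⟨1, Subgroup.one_mem _, hyx⟩
  · obtain ⟨p, ⟨hap, hpx⟩, hp⟩ := exists_isDyadicReal_between hx.1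
    obtain ⟨q, ⟨hyq, hqc⟩, hq⟩ := exists_isDyadicReal_between hy.2
    obtain ⟨h, hh, hlt⟩ := exists_bump hp hq (hpx.trans (hxy.trans hyq))
    obtain ⟨n, hn⟩ := exists_le_pow_apply (f := h) (x := x) (y := y)
      fun z hz => hlt z ⟨hpx.trans_le hz.1, hz.2.trans_lt hyq⟩
    refine ⟨h ^ n, ⟨plTwoReal_inf_supportedIn_le hap (hqc.trans_le hc.2) ?_, ?_⟩, hn⟩
    · exact Subgroup.pow_mem _ hh n
    · exact supportedIn_mono (Set.Ioo_subset_Ioo hap.le hqc.le) (Subgroup.pow_mem _ hh.2 n)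

end

/-! ### Thompson's group on the line -/

section Extend

variable {X : Type*} [LinearOrder X] {s : Set X} [s.OrdConnected]

open Classical in
theorem strictMono_ofSubtype (f : s ≃o s) : StrictMono (Equiv.Perm.ofSubtype f.toEquiv) := by
  intro x y hxy
  by_cases hx : x ∈ s <;> by_cases hy : y ∈ s
  · lift x to s using hx
    lift y to s using hy
    simpa only [Equiv.Perm.ofSubtype_apply_coe] using! f.strictMono hxy
  · rw [Equiv.Perm.ofSubtype_apply_of_mem _ hx, Equiv.Perm.ofSubtype_apply_of_not_mem _ hy]
    exact not_le.1 fun h => hy (Set.OrdConnected.out ‹_› hx (f ⟨x, hx⟩).2 ⟨hxy.le, h⟩)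
  · rw [Equiv.Perm.ofSubtype_apply_of_not_mem _ hx, Equiv.Perm.ofSubtype_apply_of_mem _ hy]
    exact not_le.1 fun h => hx (Set.OrdConnected.out ‹_› (f ⟨y, hy⟩).2 hy ⟨h, hxy.le⟩)
  · rwa [Equiv.Perm.ofSubtype_apply_of_not_mem _ hx, Equiv.Perm.ofSubtype_apply_of_not_mem _ hy]

variable (s) in
open Classical in
/-- The extension by the identity of the order automorphisms of a convex set `s` to the ambient
order. -/
noncomputable def extendHom : (s ≃o s) →* (X ≃o X) where
  toFun f := (strictMono_ofSubtype f).orderIsoOfRightInverse _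
    (Equiv.Perm.ofSubtype f.toEquiv).symm (Equiv.apply_symm_apply _)
  map_one' := RelIso.ext fun x => DFunLike.congr_fun (map_one Equiv.Perm.ofSubtype) x
  map_mul' f g :=
    RelIso.ext fun x => DFunLike.congr_fun (map_mul Equiv.Perm.ofSubtype f.toEquiv g.toEquiv) x

open Classical in
theorem extendHom_coe (f : s ≃o s) (x : s) : extendHom s f x = f x :=
  Equiv.Perm.ofSubtype_apply_coe _ x

open Classical in
theorem extendHom_of_notMem (f : s ≃o s) {x : X} (hx : x ∉ s) : extendHom s f x = x :=
  Equiv.Perm.ofSubtype_apply_of_not_mem _ hx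

theorem extendHom_injective : Function.Injective (extendHom s) := fun f g h =>
  RelIso.ext fun x => Subtype.ext <| by rw [← extendHom_coe, h, extendHom_coe]

theorem range_extendHom : (extendHom s).range = supportedIn s := by
  refine le_antisymm ?_ fun h hh => ?_
  · rintro _ ⟨f, rfl⟩
    exact mem_supportedIn.2 fun x => extendHom_of_notMem f
  · have hs (x : X) : h x ∈ s ↔ x ∈ s :=
      ⟨fun hx => by simpa only [RelIso.inv_apply_self] using
        apply_mem_of_mem_supportedIn (inv_mem hh) hx, apply_mem_of_mem_supportedIn hh⟩
    refine ⟨⟨Equiv.Perm.subtypePerm h.toEquiv hs, h.le_iff_le⟩, RelIso.ext fun x => ?_⟩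
    by_cases hx : x ∈ s
    · exact extendHom_coe _ ⟨x, hx⟩
    · rw [extendHom_of_notMem _ hx, mem_supportedIn.1 hh x hx]

end Extend

theorem extendHom_mem_supportedIn_Ioo (f : unitInterval ≃o unitInterval) :
    extendHom unitInterval f ∈ supportedIn (Set.Ioo 0 1) := by
  refine mem_supportedIn.2 fun x hx => ?_
  by_cases hxI : x ∈ unitInterval
  · obtain rfl | rfl : x = 0 ∨ x = 1 := (Set.Icc_sdiff_Ioo_same zero_le_one).subset ⟨hxI, hx⟩
    · exact (extendHom_coe f 0).trans (congrArg Subtype.val f.map_bot)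
    · exact (extendHom_coe f 1).trans (congrArg Subtype.val f.map_top)
  · exact extendHom_of_notMem f hxI

theorem isDyadicReal_extendHom {f : unitInterval ≃o unitInterval} (hf : IsPLTwo f) {x : ℝ}
    (hx : IsDyadicReal x) : IsDyadicReal (extendHom unitInterval f x) := by
  by_cases hxI : x ∈ unitInterval
  · exact extendHom_coe f ⟨x, hxI⟩ ▸ hf.dyadic ⟨x, hxI⟩ hx
  · rwa [extendHom_of_notMem f hxI]

theorem extendHom_mem_plTwoReal {f : unitInterval ≃o unitInterval} (hf : IsPLTwo f) :
    extendHom unitInterval f ∈ plTwoReal := by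
  refine ⟨fun x => ⟨fun hx => ?_, isDyadicReal_extendHom hf⟩, ?_⟩
  · simpa only [map_inv, RelIso.inv_apply_self] using isDyadicReal_extendHom hf.inv hx
  obtain ⟨D, hD, hfD⟩ := hf
  refine ⟨{0, 1} ∪ (↑) '' (D : Set unitInterval),
    (Set.toFinite _).union (D.finite_toSet.image _), ?_, fun a b hab => ?_⟩
  · rintro d ((rfl | rfl) | ⟨e, he, rfl⟩)
    exacts [.zero, .one, hD e he]
  rw [Set.disjoint_union_left, Set.disjoint_insert_left, Set.disjoint_singleton_left] at hab
  obtain ⟨⟨h0, h1⟩, habD⟩ := hab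
  by_cases hfix : ∀ x ∈ Set.Icc a b, x ∉ Set.Ioo 0 1
  · have hfix' : ∀ x ∈ Set.Icc a b, extendHom unitInterval f x = x := fun x hx =>
      mem_supportedIn.1 (extendHom_mem_supportedIn_Ioo f) x (hfix x hx)
    exact ⟨0, fun x hx y hy => by rw [hfix' x hx, hfix' y hy, zpow_zero, one_mul]⟩
  · push Not at hfix
    obtain ⟨z, hz, hz0, hz1⟩ := hfix
    have ha : a ∈ unitInterval :=
      ⟨not_lt.1 fun ha => h0 ⟨ha, hz0.trans_le hz.2⟩, hz.1.trans hz1.le⟩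
    have hb : b ∈ unitInterval :=
      ⟨hz0.le.trans hz.2, not_lt.1 fun hb => h1 ⟨hz.1.trans_lt hz1, hb⟩⟩
    obtain ⟨k, hk⟩ := hfD ⟨a, ha⟩ ⟨b, hb⟩ fun d hd hdI =>
      habD.notMem_of_mem_left (Set.mem_image_of_mem _ hd) hdI
    refine ⟨k, fun x hx y hy => ?_⟩
    lift x to unitInterval using Set.Icc_subset _ ha hb hx
    lift y to unitInterval using Set.Icc_subset _ ha hb hy
    rw [extendHom_coe, extendHom_coe]
    exact hk x hx y hy

theorem mem_thompsonF_of_extendHom {f : unitInterval ≃o unitInterval}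
    (hf : extendHom unitInterval f ∈ plTwoReal) : f ∈ thompsonF := by
  obtain ⟨-, D, hD, hDdy, hfD⟩ := hf
  have hD' : ((↑) ⁻¹' D : Set unitInterval).Finite := hD.preimage Subtype.val_injective.injOn
  refine ⟨hD'.toFinset, fun d hd => hDdy d (hD'.mem_toFinset.1 hd), fun a b hab => ?_⟩
  obtain ⟨k, hk⟩ := hfD a b <| Set.disjoint_left.2 fun d hd hdI => hab
    ⟨d, a.2.1.trans hdI.1.le, hdI.2.le.trans b.2.2⟩ (hD'.mem_toFinset.2 hd) hdI
  exact ⟨k, fun x hx y hy => by simpa only [extendHom_coe] using hk x hx y hy⟩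

theorem map_extendHom_thompsonF : thompsonF.map (extendHom unitInterval) = plTwoOn 0 1 := by
  refine le_antisymm ?_ fun h hh => ?_
  · rintro _ ⟨f, hf, rfl⟩
    exact ⟨extendHom_mem_plTwoReal hf, extendHom_mem_supportedIn_Ioo f⟩
  · obtain ⟨f, rfl⟩ : h ∈ (extendHom unitInterval).range :=
      range_extendHom.ge (supportedIn_mono Set.Ioo_subset_Icc_self hh.2)
    exact ⟨f, mem_thompsonF_of_extendHom hh.1, rfl⟩

/-- The inclusion of `F'` in the group of order automorphisms of `ℝ`. -/
noncomputable def commutatorHom : commutator thompsonF →* (ℝ ≃o ℝ) :=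
  ((extendHom unitInterval).comp thompsonF.subtype).comp (commutator thompsonF).subtype

theorem commutatorHom_injective : Function.Injective commutatorHom :=
  (extendHom_injective.comp Subtype.val_injective).comp Subtype.val_injective

theorem range_commutatorHom : commutatorHom.range = ⁅plTwoOn 0 1, plTwoOn 0 1⁆ := by
  rw [commutatorHom, MonoidHom.range_comp, Subgroup.range_subtype, commutator_def,
    Subgroup.map_commutator, ← MonoidHom.range_eq_map, MonoidHom.range_comp,
    Subgroup.range_subtype, map_extendHom_thompsonF]

theorem mem_conjugatesOf_union_inv_pow_six {f : commutator thompsonF} (hf : f ≠ 1)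
    (g : commutator thompsonF) : g ∈ (conjugatesOf f ∪ (conjugatesOf f)⁻¹) ^ 6 := by
  have hrange : commutatorHom.range = ⁅plTwoCompactOn 0 1, plTwoCompactOn 0 1⁆ :=
    range_commutatorHom.trans (commutator_plTwoOn_eq zero_lt_one)
  rw [← commutatorHom_injective.mem_set_image, Set.image_pow, image_conjugatesOf_union_inv,
    hrange]
  have hmem (x : commutator thompsonF) :
      commutatorHom x ∈ ⁅plTwoCompactOn 0 1, plTwoCompactOn 0 1⁆ := hrange ▸ ⟨x, rfl⟩
  exact (isProximalOn_plTwoCompactOn zero_lt_one).mem_signedConjugates_pow_six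
    (Subgroup.commutator_le_self _ (hmem f))
    ((map_ne_one_iff _ commutatorHom_injective).2 hf) (hmem g)

/-! ### Finite width -/

theorem exists_list_of_mem_pow {M : Type*} [Monoid M] {S : Set M} {n : ℕ} {g : M}
    (hg : g ∈ S ^ n) : ∃ l : List M, l.length = n ∧ (∀ x ∈ l, x ∈ S) ∧ l.prod = g := by
  obtain ⟨f, rfl⟩ := Set.mem_pow.1 hg
  exact ⟨List.ofFn fun i => (f i : M), List.length_ofFn, by simp, rfl⟩

theorem wordLength_le_of_mem_pow {G : Type*} [Group G] {S : Set G} {n : ℕ} {g : G}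
    (hg : g ∈ (S ∪ S⁻¹) ^ n) : wordLength S g ≤ n := by
  obtain ⟨l, rfl, hl⟩ := exists_list_of_mem_pow hg
  exact iInf₂_le l hl

theorem hasFiniteCWidth_of_mem_pow {G : Type*} [Group G] (n : ℕ)
    (h : ∀ f : G, f ≠ 1 → ∀ g : G, g ∈ (conjugatesOf f ∪ (conjugatesOf f)⁻¹) ^ n) :
    HasFiniteCWidth G := by
  intro S hS hconj
  obtain ⟨m, hm⟩ : ∃ m : ℕ, ∀ g, g ∈ (S ∪ S⁻¹) ^ m := by
    by_cases hS₁ : S ⊆ {1}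
    · have htop : (⊤ : Subgroup G) ≤ ⊥ := hS ▸ (Subgroup.closure_le _).2 hS₁
      exact ⟨0, fun g => by simpa using htop (Subgroup.mem_top g)⟩
    · obtain ⟨f, hfS, hf⟩ := Set.not_subset.1 hS₁
      have hsub : conjugatesOf f ⊆ S := fun x hx => by
        obtain ⟨c, rfl⟩ := isConj_iff.1 hx
        exact hconj c f hfS
      exact ⟨n, fun g => Set.pow_subset_pow_left
        (Set.union_subset_union hsub (Set.inv_subset_inv.2 hsub)) (h f hf g)⟩
  exact ne_top_of_le_ne_top (ENat.natCast_ne_top m)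
    (iSup_le fun g => wordLength_le_of_mem_pow (hm g))

theorem mainTheorem1 :
    (∀ f : commutator thompsonF, f ≠ 1 → ∀ g : commutator thompsonF,
      ∃ l : List (commutator thompsonF), l.length ≤ 6 ∧
        (∀ x ∈ l, x ∈ conjugatesOf f ∪ (conjugatesOf f)⁻¹) ∧ l.prod = g) ∧
    HasFiniteCWidth (commutator thompsonF) := by
  refine ⟨fun f hf g => ?_,
    hasFiniteCWidth_of_mem_pow 6 fun _ => mem_conjugatesOf_union_inv_pow_six⟩
  obtain ⟨l, hl, hlf⟩ := exists_list_of_mem_pow (mem_conjugatesOf_union_inv_pow_six hf g)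
  exact ⟨l, hl.le, hlf⟩
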